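/- **Setting.** Let $n\ge 1$ and $\alpha=\{a_1<\dots<a_k\}$ with $0<a_1$, $a_k<n$. Let $\mathbb{F}\ell(\alpha;n)$ be the manifold of flags $E_\bullet\colon E_{a_1}\subset\dots\subset E_{a_k}\subset\mathbb{C}^n$, $\dim E_{a_i}=a_i$; its dimension is $\dim(\alpha)=\sum_{i=1}^k(n-a_i)(a_i-a_{i-1})$, $a_0:=0$. For a permutation $\sigma\in S_n$ with all descents in $\alpha$ and a complete flag $F_\bullet$ in $\mathbb{C}^n$, the Schubert variety is $$X_\sigma F_\bullet=\{E_\bullet\in\mathbb{F}\ell(\alpha;n)\mid \dim (E_{a_i}\cap F_j)\ge r_\sigma(a_i,j)\ \text{for all } i,j\},\qquad r_\sigma(i,j)=|\{l\le i\mid j+\sigma(l)>n\}|,$$ which has codimension $\ell(\sigma)=|\{i<j\mid\sigma(i)>\sigma(j)\}|$. A *Grassmannian Schubert problem* is a list $(\sigma_1,\dots,\sigma_m)$ of permutations in $S_n$, each $\sigma_i$ having exactly one descent $\delta(\sigma_i)$, with $\delta(\sigma_i)\in\alpha$, such that $\ell(\sigma_1)+\dots+\ell(\sigma_m)=\dim(\alpha)$.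 Real numbers $t_1,\dots,t_m$ are *monotone* with respect to it if $\delta(\sigma_i)<\delta(\sigma_j)$ implies $t_i<t_j$, for all $i,j$. Let $\gamma\colon\mathbb{R}\to\mathbb{R}^n\subset\mathbb{C}^n$ be a rational normal curve, i.e. the image of the moment curve $t\mapsto(1,t,\dots,t^{n-1})$ under an invertible real linear map. The *osculating flag* $F_\bullet(t)$ has $j$-dimensional subspace spanned by $\gamma(t),\gamma'(t),\dots,\gamma^{(j-1)}(t)$. A complete flag is *secant to $\gamma$ along an interval $I$* if each of its subspaces is spanned by the points of $\gamma(I)$ that it contains. An intersection $X_{\sigma_1}F^1_\bullet\cap\dots\cap X_{\sigma_m}F^m_\bullet$ is *transverse with all points real* if at each of its points $E_\bullet$ every $X_{\sigma_i}F^i_\bullet$ is smooth, the codimension of the intersection of the tangent spaces of the $X_{\sigma_i}F^i_\bullet$ at $E_\bullet$ is the sum of the codimensions of these tangent spaces, and $E_\bullet$ is fixed by complex conjugation. The *Monotone Conjecture holds for* $(\sigma_1,\dots,\sigma_m)$ if for all distinct real numbers $s_1,\dots,s_m$ monotone with respect to it, the intersection $X_{\sigma_1}F_\bullet(s_1)\cap\dots\cap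 X_{\sigma_m}F_\bullet(s_m)$ is transverse with all points real. **Theorem.** Let $(\sigma_1,\dots,\sigma_m)$ be a Grassmannian Schubert problem on $\mathbb{F}\ell(\alpha;n)$ for which the Monotone Conjecture holds. Then for any distinct real numbers $t_1,\dots,t_m$ that are monotone with respect to $(\sigma_1,\dots,\sigma_m)$ there exists $\epsilon>0$ such that, if for each $i=1,\dots,m$, $F^i_\bullet$ is a complete flag secant to $\gamma$ along an interval of length $\epsilon$ containing $t_i$, then the intersection $$X_{\sigma_1}F^1_\bullet\cap X_{\sigma_2}F^2_\bullet\cap\dots\cap X_{\sigma_m}F^m_\bullet$$ is transverse with all points real. -/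

import Mathlib

open Topology

namespace SchubertCalculus

/-! ### Permutations -/

/-- The descent set of `σ ∈ S_n`: the positions `i` (counted from one) with `σ(i) > σ(i+1)`.
Elements of `Fin n` are counted from zero, so these are the positions `p = i - 1`, `q = i`. -/
def descentSet {n : ℕ} (σ : Equiv.Perm (Fin n)) : Set ℕ :=
  {i | ∃ p q : Fin n, (p : ℕ) + 1 = i ∧ (q : ℕ) = i ∧ σ q < σ p}

/-- The number of inversions `ℓ(σ)`. -/
def permLength {n : ℕ} (σ : Equiv.Perm (Fin n)) : ℕ :=
  (Finset.univ.filter fun p : Fin n × Fin n => p.1 < p.2 ∧ σ p.2 < σ p.1).card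

/-- `r_σ(i,j) = |{l ≤ i : j + σ(l) > n}|`. With positions and values counted from zero, `l ≤ i`
becomes `l < i` and `j + σ(l) > n` becomes `j + σ(l) ≥ n`. -/
def rankNumber {n : ℕ} (σ : Equiv.Perm (Fin n)) (i j : ℕ) : ℕ :=
  (Finset.univ.filter fun l : Fin n => (l : ℕ) < i ∧ n ≤ j + (σ l : ℕ)).card

/-! ### Flags and Schubert varieties -/

/-- The manifold of flags of type `α = {a_1 < ⋯ < a_k}` in `ℂⁿ`: chains of subspaces `E_a`,
`a ∈ α`, with `dim E_a = a`. -/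
def flagManifold (n : ℕ) (α : Finset ℕ) : Set (α → Submodule ℂ (Fin n → ℂ)) :=
  {E | Monotone E ∧ ∀ a : α, Module.finrank ℂ (E a) = (a : ℕ)}

/-- `dim(α) = ∑ᵢ (n - a_i)(a_i - a_{i-1})` with `a_0 = 0`. The supremum is the predecessor of `a`
in `α`, or `0` if there is none. -/
def flagDim (n : ℕ) (α : Finset ℕ) : ℕ :=
  ∑ a ∈ α, (n - a) * (a - (α.filter (· < a)).sup id)

/-- `F` is a complete flag `F_0 ⊂ F_1 ⊂ ⋯ ⊂ F_n` in `ℂⁿ` (so `F_0 = 0`, `F_n = ℂⁿ`). -/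
def IsCompleteFlag {n : ℕ} (F : Fin (n + 1) → Submodule ℂ (Fin n → ℂ)) : Prop :=
  Monotone F ∧ ∀ j, Module.finrank ℂ (F j) = (j : ℕ)

/-- The Schubert variety `X_σ F` in the manifold of flags of type `α`. -/
def schubertVariety {n : ℕ} (α : Finset ℕ) (σ : Equiv.Perm (Fin n))
    (F : Fin (n + 1) → Submodule ℂ (Fin n → ℂ)) : Set (α → Submodule ℂ (Fin n → ℂ)) :=
  {E | E ∈ flagManifold n α ∧
    ∀ (a : α) (j : Fin (n + 1)), rankNumber σ a j ≤ Module.finrank ℂ ↥(E a ⊓ F j)}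

/-- `(σ_1, …, σ_m)` is a Grassmannian Schubert problem for flags of type `α` in `ℂⁿ`, where `σ_i`
has its only descent at `δ_i ∈ α`. -/
structure IsGrassmannianSchubertProblem {n m : ℕ} (α : Finset ℕ)
    (σ : Fin m → Equiv.Perm (Fin n)) (δ : Fin m → ℕ) : Prop where
  descent : ∀ i, descentSet (σ i) = {δ i}
  descent_mem : ∀ i, δ i ∈ α
  sum_permLength : ∑ i, permLength (σ i) = flagDim n α

/-- The intersection `X_{σ_1} F^1 ∩ ⋯ ∩ X_{σ_m} F^m` in the manifold of flags of type `α`. -/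
def schubertIntersection {n m : ℕ} (α : Finset ℕ) (σ : Fin m → Equiv.Perm (Fin n))
    (F : Fin m → Fin (n + 1) → Submodule ℂ (Fin n → ℂ)) :
    Set (α → Submodule ℂ (Fin n → ℂ)) :=
  {E | E ∈ flagManifold n α ∧ ∀ i, E ∈ schubertVariety α (σ i) (F i)}

/-! ### Transversality and reality -/

/-- The family of subspaces `h E`, for an endomorphism `h` of `ℂⁿ`. -/
def translateFlag {n : ℕ} {α : Finset ℕ} (h : (Fin n → ℂ) →L[ℂ] (Fin n → ℂ))
    (E : α → Submodule ℂ (Fin n → ℂ)) : α → Submodule ℂ (Fin n → ℂ) :=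
  fun a => (E a).map (h : (Fin n → ℂ) →ₗ[ℂ] (Fin n → ℂ))

/-- `X` is, near the flag `E`, a complex submanifold of codimension `c` of the flag manifold with
tangent space `T` at `E`; that is, `E` is a smooth point of `X`, where `X` has codimension `c`.

The orbit map `h ↦ h E` from `GL_n(ℂ)` (an open subset of `End(ℂⁿ)`) to the flag manifold is a
surjective holomorphic submersion, so the manifold structure near `E` is read off near
`h = 1`: the preimage of `X` is cut out there by `c` holomorphic equations with independent
differentials. The tangent space of the flag manifold at `E` is the quotient of `End(ℂⁿ)` by the
endomorphisms that preserve `E`; `T` is the preimage in `End(ℂⁿ)` of the tangent space of `X`,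
and has the same codimension. -/
def IsSmoothAt {n : ℕ} {α : Finset ℕ} (X : Set (α → Submodule ℂ (Fin n → ℂ)))
    (E : α → Submodule ℂ (Fin n → ℂ)) (c : ℕ)
    (T : Submodule ℂ ((Fin n → ℂ) →L[ℂ] (Fin n → ℂ))) : Prop :=
  ∃ f : ((Fin n → ℂ) →L[ℂ] (Fin n → ℂ)) → (Fin c → ℂ),
    AnalyticAt ℂ f 1 ∧
    (∀ᶠ h in 𝓝 (1 : (Fin n → ℂ) →L[ℂ] (Fin n → ℂ)), translateFlag h E ∈ X ↔ f h = 0) ∧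
    Function.Surjective (fderiv ℂ f 1) ∧
    T = LinearMap.ker (fderiv ℂ f 1 : ((Fin n → ℂ) →L[ℂ] (Fin n → ℂ)) →ₗ[ℂ] (Fin c → ℂ))

/-- The intersection `X_{σ_1} F^1 ∩ ⋯ ∩ X_{σ_m} F^m` is transverse: at each of its points `E`,
every `X_{σ_i} F^i` (which has codimension `ℓ(σ_i)`) is smooth, and the tangent spaces are in
general position, i.e. the codimension of their intersection is the sum of their codimensions. -/
def IsTransverse {n m : ℕ} (α : Finset ℕ) (σ : Fin m → Equiv.Perm (Fin n))
    (F : Fin m → Fin (n + 1) → Submodule ℂ (Fin n → ℂ)) : Prop :=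
  ∀ E ∈ schubertIntersection α σ F,
    ∃ T : Fin m → Submodule ℂ ((Fin n → ℂ) →L[ℂ] (Fin n → ℂ)),
      (∀ i, IsSmoothAt (schubertVariety α (σ i) (F i)) E (permLength (σ i)) (T i)) ∧
      Module.finrank ℂ (((Fin n → ℂ) →L[ℂ] (Fin n → ℂ)) ⧸ (⨅ i, T i)) =
        ∑ i, Module.finrank ℂ (((Fin n → ℂ) →L[ℂ] (Fin n → ℂ)) ⧸ T i)

/-- A flag is real if each of its subspaces is stable under complex conjugation. -/
def IsRealFlag {n : ℕ} {α : Finset ℕ} (E : α → Submodule ℂ (Fin n → ℂ)) : Prop :=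
  ∀ (a : α), ∀ v ∈ E a, (fun i => (starRingEnd ℂ) (v i)) ∈ E a

/-- `X_{σ_1} F^1 ∩ ⋯ ∩ X_{σ_m} F^m` is transverse with all points real. -/
def IsTransverseWithAllPointsReal {n m : ℕ} (α : Finset ℕ) (σ : Fin m → Equiv.Perm (Fin n))
    (F : Fin m → Fin (n + 1) → Submodule ℂ (Fin n → ℂ)) : Prop :=
  IsTransverse α σ F ∧ ∀ E ∈ schubertIntersection α σ F, IsRealFlag E

/-! ### Osculating and secant flags of a rational normal curve -/

/-- The inclusion `ℝⁿ ⊂ ℂⁿ`. -/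
def complexify {n : ℕ} (v : Fin n → ℝ) : Fin n → ℂ := fun i => (v i : ℂ)

/-- `γ : ℝ → ℝⁿ` is a rational normal curve: an image of the moment curve
`t ↦ (1, t, …, t^{n-1})` under an invertible real linear map. (The moment curve lies in the
hyperplane `x_1 = 1`, on which every affine map is linear.) -/
def IsRationalNormalCurve {n : ℕ} (γ : ℝ → Fin n → ℝ) : Prop :=
  ∃ L : (Fin n → ℝ) ≃ₗ[ℝ] (Fin n → ℝ), ∀ t, γ t = L fun i => t ^ (i : ℕ)

/-- The flag osculating `γ` at `t`: its `j`-dimensional subspace is spanned by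
`γ(t), γ'(t), …, γ^{(j-1)}(t)`. -/
def osculatingFlag {n : ℕ} (γ : ℝ → Fin n → ℝ) (t : ℝ) :
    Fin (n + 1) → Submodule ℂ (Fin n → ℂ) :=
  fun j => Submodule.span ℂ ((fun l => complexify (iteratedDeriv l γ t)) '' {l : ℕ | l < (j : ℕ)})

/-- The flag `F` is secant to `γ` along `I`: each of its subspaces is spanned by the points of
`γ(I)` that it contains. -/
def IsSecantAlong {n : ℕ} (γ : ℝ → Fin n → ℝ) (I : Set ℝ)
    (F : Fin (n + 1) → Submodule ℂ (Fin n → ℂ)) : Prop :=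
  ∀ j, Submodule.span ℂ ((F j : Set (Fin n → ℂ)) ∩ (fun s => complexify (γ s)) '' I) = F j

/-- The real numbers `t_1, …, t_m` are monotone with respect to the types `δ_1, …, δ_m`. -/
def IsMonotonePoints {m : ℕ} (δ : Fin m → ℕ) (t : Fin m → ℝ) : Prop :=
  ∀ i j, δ i < δ j → t i < t j

/-- The Monotone Conjecture for the Grassmannian Schubert problem `(σ_1, …, σ_m)` with descents
`δ_1, …, δ_m`, on flags of type `α`, and the rational normal curve `γ`: for all distinct real
numbers that are monotone with respect to the problem, the intersection of the Schubert varieties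
defined by the flags osculating `γ` at these points is transverse with all points real. -/
def MonotoneConjectureHolds {n m : ℕ} (γ : ℝ → Fin n → ℝ) (α : Finset ℕ)
    (σ : Fin m → Equiv.Perm (Fin n)) (δ : Fin m → ℕ) : Prop :=
  ∀ t : Fin m → ℝ, Function.Injective t → IsMonotonePoints δ t →
    IsTransverseWithAllPointsReal α σ fun i => osculatingFlag γ (t i)

end SchubertCalculus

open SchubertCalculus

/-!
Transversality together with reality of all points is an open condition on the flags defining a
zero-dimensional intersection of Schubert varieties, and flags secant to `γ` along short intervals
around `t` are close to the flag osculating `γ` at `t`. So the hypothesis, applied at `t_1, …, t_m`,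
gives the conclusion for all small `ε`. Closeness of flags is always expressed by
endomorphisms of `ℂⁿ` close to the identity that carry one flag to the other.

* In coordinates where `γ` is the moment curve, the `j`-dimensional subspace of a flag secant to `γ`
  is spanned by points `γ(s_0), …, γ(s_{j-1})`, and is the common zero space of the functionals
  given by the Newton polynomials `∏_{l < i} (X - s_l)`, `i ≥ j`. For the osculating flag the same
  holds with all nodes equal to `t`. As the coefficients of these polynomials depend continuously on the
  nodes, secant flags converge to the osculating flag (`exists_endo_of_isSecantAlong`).
* If the theorem failed, there would be secant flags along intervals of length tending to zero, and
  for each of them a point of the intersection at which it is not transverse or which is not real.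
  The flag manifold is compact (`exists_subseq_tendsto_flag`) and Schubert varieties are closed
  (`mem_schubertVariety_of_tendsto`), so these points accumulate at a point `E` of the
  intersection for the osculating flags, where the hypothesis applies.
* Pulled back to `End(ℂⁿ)` along the orbit map `h ↦ h E`, the Schubert varieties near `E` are
  the zero sets of analytic maps whose joint differential is surjective. Surjectivity is an open
  condition, so nearby intersections are transverse near `E` (`exists_nhds_transverse`).
* Since the codimensions add up to the dimension of the flag manifold, the kernel of the joint
  differential is exactly the stabilizer of `E` (`ker_jointDeriv_eq`). On a complement of it the
  equations are injective near `1`, uniformly in small motions of the varieties, so a nearby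
  intersection has at most one point near `E` (`exists_nhds_unique`). Secant flags are real, so the
  complex conjugate of such a point is in the intersection too; as `E` is real, it is
  again near `E`. Hence it is the same point, which is therefore real.
-/

-- Instance search on spaces of continuous linear maps needs this depth.
set_option maxSynthPendingDepth 3

namespace SchubertCalculus

/-! ### Newton polynomials and the convergence of secant flags -/

/-- The endomorphisms of `ℂⁿ`, as a normed algebra. -/
abbrev Endo (n : ℕ) := (Fin n → ℂ) →L[ℂ] (Fin n → ℂ)

lemma bijective_of_isUnit {n : ℕ} {g : Endo n} (hg : IsUnit g) : Function.Bijective g :=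
  ContinuousLinearMap.isUnit_iff_bijective.1 hg

open Polynomial in
/-- The Newton polynomial `∏_{l < i} (X - s_l)`. -/
noncomputable def newtonPoly (s : ℕ → ℝ) (i : ℕ) : ℝ[X] :=
  ∏ l ∈ Finset.range i, (X - C (s l))

open Polynomial in
lemma newtonPoly_succ (s : ℕ → ℝ) (i : ℕ) :
    newtonPoly s (i + 1) = newtonPoly s i * (X - C (s i)) :=
  Finset.prod_range_succ _ _

lemma newtonPoly_monic (s : ℕ → ℝ) (i : ℕ) : (newtonPoly s i).Monic :=
  Polynomial.monic_prod_of_monic _ _ fun _ _ => Polynomial.monic_X_sub_C _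

lemma newtonPoly_natDegree (s : ℕ → ℝ) (i : ℕ) : (newtonPoly s i).natDegree = i := by
  rw [newtonPoly, Polynomial.natDegree_prod_of_monic _ _ fun _ _ => Polynomial.monic_X_sub_C _]
  simp

lemma continuous_newtonPoly_coeff (i k : ℕ) :
    Continuous fun s : ℕ → ℝ => (newtonPoly s i).coeff k := by
  induction i generalizing k with
  | zero => simpa [newtonPoly] using continuous_const
  | succ i ih =>
    simp only [newtonPoly_succ]
    cases k with
    | zero =>
      simp only [Polynomial.mul_coeff_zero]
      refine (ih 0).mul ?_
      simp only [Polynomial.coeff_sub, Polynomial.coeff_X_zero, Polynomial.coeff_C_zero]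
      fun_prop
    | succ k =>
      simp only [Polynomial.coeff_mul_X_sub_C]
      exact (ih k).sub ((ih (k + 1)).mul (continuous_apply i))

/-- The matrix whose rows are the coefficients of the Newton polynomials. -/
noncomputable def newtonMatrix (n : ℕ) (s : ℕ → ℝ) : Matrix (Fin n) (Fin n) ℝ :=
  Matrix.of fun i k => (newtonPoly s i).coeff k

lemma newtonMatrix_det (n : ℕ) (s : ℕ → ℝ) : (newtonMatrix n s).det = 1 := by
  rw [Matrix.det_of_isLowerTriangular]
  · refine Finset.prod_eq_one fun i _ => ?_
    have := newtonPoly_monic s i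
    rwa [Polynomial.Monic, Polynomial.leadingCoeff, newtonPoly_natDegree] at this
  · intro i j hij
    change (newtonPoly s i).coeff j = 0
    refine Polynomial.coeff_eq_zero_of_natDegree_lt ?_
    rw [newtonPoly_natDegree]
    exact hij

lemma continuous_newtonMatrix (n : ℕ) : Continuous (newtonMatrix n) :=
  continuous_matrix fun _ _ => continuous_newtonPoly_coeff _ _

lemma newtonMatrix_mulVec (n : ℕ) (s : ℕ → ℝ) (u : ℝ) (i : Fin n) :
    (newtonMatrix n s).mulVec (fun k : Fin n => u ^ (k : ℕ)) i = (newtonPoly s i).eval u := by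
  rw [Polynomial.eval_eq_sum_range' (n := n) (by rw [newtonPoly_natDegree]; exact i.2)]
  simp [Matrix.mulVec, dotProduct, newtonMatrix, Finset.sum_range]

/-- A real matrix, acting on `ℂⁿ`. -/
noncomputable def realEndo {n : ℕ} (A : Matrix (Fin n) (Fin n) ℝ) : Endo n :=
  LinearMap.toContinuousLinearMap (Matrix.toLin' (A.map Complex.ofReal))

lemma realEndo_complexify {n : ℕ} (A : Matrix (Fin n) (Fin n) ℝ) (v : Fin n → ℝ) :
    realEndo A (complexify v) = complexify (A.mulVec v) := by
  ext i
  simp [realEndo, complexify, Matrix.mulVec, dotProduct]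

lemma realEndo_mul {n : ℕ} (A B : Matrix (Fin n) (Fin n) ℝ) :
    realEndo (A * B) = realEndo A * realEndo B := by
  ext v i
  have : (A * B).map Complex.ofReal = A.map Complex.ofReal * B.map Complex.ofReal :=
    Matrix.map_mul (f := Complex.ofRealHom)
  simp [realEndo, this]

lemma realEndo_one {n : ℕ} : realEndo (1 : Matrix (Fin n) (Fin n) ℝ) = 1 := by
  ext v i
  have : (1 : Matrix (Fin n) (Fin n) ℝ).map Complex.ofReal = 1 :=
    Matrix.map_one _ Complex.ofReal_zero Complex.ofReal_one
  simp [realEndo, this]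

lemma continuous_realEndo {n : ℕ} : Continuous (realEndo (n := n)) := by
  have h1 : Continuous fun A : Matrix (Fin n) (Fin n) ℝ => A.map Complex.ofReal :=
    continuous_id.matrix_map Complex.continuous_ofReal
  let T : Matrix (Fin n) (Fin n) ℂ →ₗ[ℂ] Endo n :=
    LinearMap.toContinuousLinearMap.toLinearMap ∘ₗ Matrix.toLin'.toLinearMap
  have h2 : Continuous T := LinearMap.continuous_of_finiteDimensional T
  exact h2.comp h1

/-- The span of the first `j` coordinate vectors of `ℂⁿ`. -/
noncomputable def coordFlag (n : ℕ) (j : Fin (n + 1)) : Submodule ℂ (Fin n → ℂ) :=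
  (Pi.basisFun ℂ (Fin n)).flag j

lemma mem_coordFlag {n : ℕ} {j : Fin (n + 1)} {v : Fin n → ℂ} :
    v ∈ coordFlag n j ↔ ∀ i : Fin n, (j : ℕ) ≤ i → v i = 0 := by
  rw [coordFlag, Module.Basis.flag, Module.Basis.mem_span_image]
  simp only [Set.subset_def, Finset.mem_coe, Finsupp.mem_support_iff, Pi.basisFun_repr,
    Set.mem_ofPred_eq]
  refine forall_congr' fun i => ?_
  rw [not_imp_comm, Fin.lt_def, not_lt]
  rfl

lemma finrank_coordFlag_le {n : ℕ} (j : Fin (n + 1)) :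
    Module.finrank ℂ (coordFlag n j) ≤ j := by
  classical
  rw [coordFlag, Module.Basis.flag]
  refine (finrank_span_le_card _).trans ?_
  rw [Set.toFinset_image]
  refine Finset.card_image_le.trans ?_
  rw [← Finset.card_range (j : ℕ)]
  refine Finset.card_le_card_of_injOn (fun i : Fin n => (i : ℕ)) ?_
    (fun a _ b _ h => Fin.ext h)
  intro i hi
  simpa [Fin.lt_def] using hi

/-- A rational normal curve becomes the moment curve after an invertible real change of
coordinates. -/
lemma IsRationalNormalCurve.exists_matrix {n : ℕ} {γ : ℝ → Fin n → ℝ}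
    (hγ : IsRationalNormalCurve γ) :
    ContDiff ℝ ⊤ γ ∧ ∃ B : Matrix (Fin n) (Fin n) ℝ, IsUnit B ∧
      ∀ u, B.mulVec (γ u) = fun i : Fin n => u ^ (i : ℕ) := by
  obtain ⟨L, hL⟩ := hγ
  refine ⟨?_, LinearMap.toMatrix' L.symm.toLinearMap, ?_, fun u => ?_⟩
  · have : γ = L.toContinuousLinearEquiv ∘ fun t (i : Fin n) => t ^ (i : ℕ) := funext hL
    rw [this]
    refine L.toContinuousLinearEquiv.contDiff.comp (contDiff_pi.2 fun i => ?_)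
    fun_prop
  · refine IsUnit.of_mul_eq_one (LinearMap.toMatrix' L.toLinearMap) ?_
    rw [← LinearMap.toMatrix'_comp]
    simp
  · rw [hL, ← Matrix.toLin'_apply, Matrix.toLin'_toMatrix']
    simp

/-- The linear map that sends `γ(u)` to the values at `u` of the Newton polynomials with
nodes `s`. -/
noncomputable def newtonEndo {n : ℕ} (B : Matrix (Fin n) (Fin n) ℝ) (s : ℕ → ℝ) : Endo n :=
  realEndo (newtonMatrix n s * B)

lemma isUnit_newtonEndo {n : ℕ} {B : Matrix (Fin n) (Fin n) ℝ} (hB : IsUnit B) (s : ℕ → ℝ) :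
    IsUnit (newtonEndo B s) := by
  have h : IsUnit (newtonMatrix n s * B) := by
    refine IsUnit.mul ?_ hB
    rw [Matrix.isUnit_iff_isUnit_det, newtonMatrix_det]
    exact isUnit_one
  obtain ⟨⟨A, A', h1, h2⟩, hA⟩ := h
  refine ⟨⟨realEndo A, realEndo A', ?_, ?_⟩, ?_⟩
  · rw [← realEndo_mul, h1, realEndo_one]
  · rw [← realEndo_mul, h2, realEndo_one]
  · exact congrArg realEndo hA

lemma continuous_newtonEndo {n : ℕ} (B : Matrix (Fin n) (Fin n) ℝ) :
    Continuous (newtonEndo B) :=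
  continuous_realEndo.comp ((continuous_newtonMatrix n).matrix_mul continuous_const)

lemma finrank_comap_newtonEndo_le {n : ℕ} {B : Matrix (Fin n) (Fin n) ℝ} (hB : IsUnit B)
    (s : ℕ → ℝ) (j : Fin (n + 1)) :
    Module.finrank ℂ ((coordFlag n j).comap (newtonEndo B s).toLinearMap) ≤ j := by
  refine le_trans ?_ (finrank_coordFlag_le j)
  refine LinearMap.finrank_le_finrank_of_injective
    (f := (newtonEndo B s).toLinearMap.restrict (p := (coordFlag n j).comap _)
      (fun _ hx => hx)) ?_
  intro x y hxy
  exact Subtype.ext ((bijective_of_isUnit (isUnit_newtonEndo hB s)).1 (congrArg Subtype.val hxy))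

/-- The osculating flag at `t` is cut out by the Newton polynomials `(X - t)^i`, whose
derivatives at `t` of order other than `i` vanish. -/
lemma osculatingFlag_eq_comap {n : ℕ} {γ : ℝ → Fin n → ℝ} (hγ : ContDiff ℝ ⊤ γ)
    {B : Matrix (Fin n) (Fin n) ℝ} (hB : IsUnit B)
    (hBγ : ∀ u, B.mulVec (γ u) = fun i : Fin n => u ^ (i : ℕ)) (t : ℝ) (j : Fin (n + 1)) :
    osculatingFlag γ t j = (coordFlag n j).comap (newtonEndo B fun _ => t).toLinearMap := by
  set A := newtonMatrix n (fun _ => t) * B with hA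
  have key : ∀ (l : ℕ) (i : Fin n),
      A.mulVec (iteratedDeriv l γ t) i = if l = i then ((i : ℕ).factorial : ℝ) else 0 := by
    intro l i
    let φ : (Fin n → ℝ) →L[ℝ] ℝ :=
      LinearMap.toContinuousLinearMap (LinearMap.proj i ∘ₗ Matrix.toLin' A)
    have h1 : φ (iteratedDeriv l γ t) = iteratedDeriv l (φ ∘ γ) t := by
      rw [iteratedDeriv_eq_iteratedFDeriv, iteratedDeriv_eq_iteratedFDeriv,
        φ.iteratedFDeriv_comp_left (hγ.contDiffAt) (i := l) (by exact_mod_cast le_top)]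
      rfl
    have h2 : (φ ∘ γ) = fun u => (fun x : ℝ => x ^ (i : ℕ)) (u - t) := by
      funext u
      change A.mulVec (γ u) i = _
      rw [hA, ← Matrix.mulVec_mulVec, hBγ, newtonMatrix_mulVec]
      simp [newtonPoly]
    change φ (iteratedDeriv l γ t) = _
    rw [h1, h2, iteratedDeriv_comp_sub_const (f := fun x : ℝ => x ^ (i : ℕ))]
    simp only [sub_self]
    rw [iteratedDeriv_fun_pow_zero]
    push_cast
    rfl
  have key2 : ∀ l : ℕ, newtonEndo B (fun _ => t) (complexify (iteratedDeriv l γ t)) =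
      complexify (A.mulVec (iteratedDeriv l γ t)) := fun l => realEndo_complexify _ _
  apply le_antisymm
  · rw [osculatingFlag, Submodule.span_le]
    rintro _ ⟨l, hl, rfl⟩
    change newtonEndo B _ _ ∈ coordFlag n j
    rw [key2, mem_coordFlag]
    intro i hi
    simp only [complexify, key]
    rw [if_neg (by have : l < j := hl; omega)]
    simp
  · have h3 : coordFlag n j ≤ (osculatingFlag γ t j).map (newtonEndo B fun _ => t).toLinearMap := by
      rw [coordFlag, Module.Basis.flag, Submodule.span_le]
      rintro _ ⟨i, hi, rfl⟩
      refine ⟨((i : ℕ).factorial : ℂ)⁻¹ • complexify (iteratedDeriv i γ t),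
        Submodule.smul_mem _ _ (Submodule.subset_span ⟨i, hi, rfl⟩), ?_⟩
      rw [map_smul]
      change _ • newtonEndo B _ _ = _
      rw [key2]
      ext k
      have hf : ((i : ℕ).factorial : ℂ) ≠ 0 := by exact_mod_cast (i : ℕ).factorial_ne_zero
      by_cases hik : i = k
      · subst hik
        simp [complexify, key, hf]
      · have : ¬ ((i : ℕ) = k) := fun h => hik (Fin.ext h)
        simp [complexify, key, this, Ne.symm hik]
    intro v hv
    obtain ⟨w, hw, hwv⟩ := h3 hv
    exact (bijective_of_isUnit (isUnit_newtonEndo hB _)).1 hwv ▸ hw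

/-- The subspaces of a secant flag are spanned by points `γ(s_0), …, γ(s_{j-1})`, and cut out by
the Newton polynomials with nodes `s`. -/
lemma IsSecantAlong.exists_nodes {n : ℕ} {γ : ℝ → Fin n → ℝ}
    {B : Matrix (Fin n) (Fin n) ℝ} (hB : IsUnit B)
    (hBγ : ∀ u, B.mulVec (γ u) = fun i : Fin n => u ^ (i : ℕ))
    {I : Set ℝ} {F : Fin (n + 1) → Submodule ℂ (Fin n → ℂ)} (hF : IsCompleteFlag F)
    (hsec : IsSecantAlong γ I F) {t : ℝ} (ht : t ∈ I) :
    ∃ s : ℕ → ℝ, (∀ l, s l ∈ I) ∧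
      ∀ j, F j = (coordFlag n j).comap (newtonEndo B s).toLinearMap := by
  -- `F j.succ` is spanned by points of the curve, so one of these is outside `F j.castSucc`.
  have h1 : ∀ j : Fin n, ∃ u ∈ I, complexify (γ u) ∈ F j.succ ∧
      complexify (γ u) ∉ F j.castSucc := by
    intro j
    by_contra! hcon
    have hle : F j.succ ≤ F j.castSucc := by
      rw [← hsec j.succ, Submodule.span_le]
      rintro _ ⟨hv, u, hu, rfl⟩
      exact hcon u hu hv
    have := Submodule.finrank_mono hle
    rw [hF.2, hF.2] at this
    simp at this
  choose s hsI hs hs' using h1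
  -- Only the first `n` nodes matter.
  let s' : ℕ → ℝ := fun l => if h : l < n then s ⟨l, h⟩ else t
  have hs'I : ∀ l, s' l ∈ I := by
    intro l
    by_cases h : l < n
    · simpa [s', h] using hsI _
    · simpa [s', h] using ht
  refine ⟨s', hs'I, fun j => ?_⟩
  have hle : F j ≤ (coordFlag n j).comap (newtonEndo B s').toLinearMap := by
    induction j using Fin.induction with
    | zero =>
      have h0 := hF.2 0
      simp only [Fin.val_zero, Submodule.finrank_eq_zero] at h0
      rw [h0]; exact bot_le
    | succ j ih =>
      have heq : F j.castSucc ⊔ Submodule.span ℂ {complexify (γ (s j))} = F j.succ := by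
        have hsup : F j.castSucc ⊔ Submodule.span ℂ {complexify (γ (s j))} ≤ F j.succ :=
          sup_le (hF.1 (Fin.castSucc_lt_succ (i := j)).le)
            (by rw [Submodule.span_le]; simpa using hs j)
        refine Submodule.eq_of_le_of_finrank_le hsup ?_
        have hlt : F j.castSucc < F j.castSucc ⊔ Submodule.span ℂ {complexify (γ (s j))} := by
          refine lt_of_le_of_ne le_sup_left fun h => hs' j ?_
          rw [h]
          exact Submodule.mem_sup_right (Submodule.mem_span_singleton_self _)
        have := Submodule.finrank_lt_finrank_of_lt hlt
        rw [hF.2] at this ⊢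
        simpa using this
      rw [← heq]
      refine sup_le (ih.trans (Submodule.comap_mono ?_)) ?_
      · exact (Pi.basisFun ℂ (Fin n)).flag_mono (Fin.castSucc_lt_succ (i := j)).le
      · rw [Submodule.span_le, Set.singleton_subset_iff]
        change newtonEndo B s' _ ∈ coordFlag n _
        rw [newtonEndo, realEndo_complexify, mem_coordFlag]
        intro i hi
        have hji : (j : ℕ) < i := by simpa using hi
        simp only [complexify]
        rw [← Matrix.mulVec_mulVec, hBγ, newtonMatrix_mulVec, newtonPoly, Polynomial.eval_prod,
          Finset.prod_eq_zero (Finset.mem_range.2 hji)]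
        · simp
        · simp [s']
  exact Submodule.eq_of_le_of_finrank_le hle
    ((finrank_comap_newtonEndo_le hB s' j).trans (hF.2 j).ge)

/-- Flags secant along intervals that shrink to `t` converge to the osculating flag at `t`. -/
lemma exists_endo_of_isSecantAlong {n : ℕ} {γ : ℝ → Fin n → ℝ} (hγ : IsRationalNormalCurve γ)
    (t : ℝ) {F : ℕ → Fin (n + 1) → Submodule ℂ (Fin n → ℂ)} (hF : ∀ k, IsCompleteFlag (F k))
    {ε : ℕ → ℝ} (hε : Filter.Tendsto ε Filter.atTop (𝓝 0))
    (hsec : ∀ k, ∃ u : ℝ, t ∈ Set.Icc u (u + ε k) ∧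
      IsSecantAlong γ (Set.Icc u (u + ε k)) (F k)) :
    ∃ q : ℕ → Endo n, Filter.Tendsto q Filter.atTop (𝓝 1) ∧ (∀ k, IsUnit (q k)) ∧
      ∀ k j, osculatingFlag γ t j = (F k j).map (q k).toLinearMap := by
  obtain ⟨hγd, B, hB, hBγ⟩ := hγ.exists_matrix
  choose u htu hsec using hsec
  choose s hsI hs using fun k => (hsec k).exists_nodes hB hBγ (hF k) (htu k)
  obtain ⟨G, hG⟩ := isUnit_newtonEndo hB (fun _ => t)
  have hst : Filter.Tendsto s Filter.atTop (𝓝 fun _ => t) := by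
    rw [tendsto_pi_nhds]
    intro l
    rw [tendsto_iff_dist_tendsto_zero]
    refine squeeze_zero (fun _ => dist_nonneg) (fun k => ?_) hε
    have := Real.dist_le_of_mem_Icc (hsI k l) (htu k)
    simpa using this
  refine ⟨fun k => ↑G⁻¹ * newtonEndo B (s k), ?_, fun k => ?_, fun k j => ?_⟩
  · have h1 : Filter.Tendsto (fun k => newtonEndo B (s k)) Filter.atTop (𝓝 (G : Endo n)) := by
      rw [hG]
      exact ((continuous_newtonEndo B).tendsto _).comp hst
    have h2 := (h1.const_mul (↑G⁻¹ : Endo n))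
    rwa [Units.inv_mul] at h2
  · exact (Units.isUnit _).mul (isUnit_newtonEndo hB _)
  · rw [osculatingFlag_eq_comap hγd hB hBγ, hs]
    have hGq : (G : Endo n) * (↑G⁻¹ * newtonEndo B (s k)) = newtonEndo B (s k) := by simp
    ext v
    constructor
    · intro hv
      obtain ⟨w, hw⟩ := (bijective_of_isUnit ((Units.isUnit G⁻¹).mul
        (isUnit_newtonEndo hB (s k)))).2 v
      refine ⟨w, ?_, hw⟩
      change newtonEndo B (s k) w ∈ coordFlag n j
      rw [← hGq]
      change G.1 ((↑G⁻¹ * newtonEndo B (s k)) w) ∈ _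
      rw [hw, hG]
      exact hv
    · rintro ⟨w, hw, rfl⟩
      change newtonEndo B (fun _ => t) ((↑G⁻¹ * newtonEndo B (s k)) w) ∈ coordFlag n j
      rw [← hG]
      change (G.1 * (↑G⁻¹ * newtonEndo B (s k))) w ∈ coordFlag n j
      rw [hGq]
      exact hw

variable {n m : ℕ} {α : Finset ℕ}

/-! ### Translations of flags and of Schubert varieties -/

lemma translateFlag_mul (g h : Endo n) (E : α → Submodule ℂ (Fin n → ℂ)) :
    translateFlag (g * h) E = translateFlag g (translateFlag h E) :=
  funext fun a => Submodule.map_comp (h : (Fin n → ℂ) →ₗ[ℂ] (Fin n → ℂ))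
    (g : (Fin n → ℂ) →ₗ[ℂ] (Fin n → ℂ)) (E a)

lemma finrank_map_of_isUnit {g : Endo n} (hg : IsUnit g) (A : Submodule ℂ (Fin n → ℂ)) :
    Module.finrank ℂ (A.map g.toLinearMap) = Module.finrank ℂ A :=
  (Submodule.equivMapOfInjective g.toLinearMap (bijective_of_isUnit hg).1 A).finrank_eq.symm

lemma translateFlag_mem_flagManifold_iff {g : Endo n} (hg : IsUnit g)
    {E : α → Submodule ℂ (Fin n → ℂ)} :
    translateFlag g E ∈ flagManifold n α ↔ E ∈ flagManifold n α := by
  refine and_congr ?_ (forall_congr' fun a => ?_)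
  · exact forall_congr' fun a => forall_congr' fun b => forall_congr' fun _ =>
      Submodule.map_le_map_iff_of_injective (f := g.toLinearMap) (bijective_of_isUnit hg).1 _ _
  · rw [translateFlag, finrank_map_of_isUnit hg]

lemma translateFlag_mem_schubertVariety_iff {g : Endo n} (hg : IsUnit g)
    (σ : Equiv.Perm (Fin n)) {F F' : Fin (n + 1) → Submodule ℂ (Fin n → ℂ)}
    (hF : ∀ j, F j = (F' j).map g.toLinearMap) {E : α → Submodule ℂ (Fin n → ℂ)} :
    translateFlag g E ∈ schubertVariety α σ F ↔ E ∈ schubertVariety α σ F' := by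
  refine and_congr (translateFlag_mem_flagManifold_iff hg)
    (forall_congr' fun a => forall_congr' fun j => ?_)
  rw [hF, translateFlag, ← Submodule.map_inf _ (bijective_of_isUnit hg).1,
    finrank_map_of_isUnit hg]

lemma eventually_isUnit : ∀ᶠ x in 𝓝 (1 : Endo n), IsUnit x :=
  Units.isOpen.mem_nhds isUnit_one

/-! ### Semicontinuity and compactness -/

/-- Every subspace of `ℂⁿ` is the image of a projection of norm bounded independently of the
subspace, such as the orthogonal projection. -/
lemma exists_bounded_isProj (n : ℕ) : ∃ C : ℝ, ∀ S : Submodule ℂ (Fin n → ℂ),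
    ∃ p : Endo n, ‖p‖ ≤ C ∧ LinearMap.IsProj S p := by
  let e : EuclideanSpace ℂ (Fin n) ≃L[ℂ] (Fin n → ℂ) := EuclideanSpace.equiv (Fin n) ℂ
  refine ⟨‖(e : EuclideanSpace ℂ (Fin n) →L[ℂ] (Fin n → ℂ))‖ *
    ‖(e.symm : (Fin n → ℂ) →L[ℂ] EuclideanSpace ℂ (Fin n))‖, fun S => ?_⟩
  let S' : Submodule ℂ (EuclideanSpace ℂ (Fin n)) :=
    S.comap (e : EuclideanSpace ℂ (Fin n) →L[ℂ] (Fin n → ℂ)).toLinearMap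
  refine ⟨(e : EuclideanSpace ℂ (Fin n) →L[ℂ] (Fin n → ℂ)).comp
    (S'.starProjection.comp (e.symm : (Fin n → ℂ) →L[ℂ] EuclideanSpace ℂ (Fin n))), ?_, ?_, ?_⟩
  · refine (ContinuousLinearMap.opNorm_comp_le _ _).trans ?_
    gcongr
    refine (ContinuousLinearMap.opNorm_comp_le _ _).trans ?_
    exact (mul_le_mul_of_nonneg_right S'.starProjection_norm_le (norm_nonneg _)).trans_eq
      (one_mul _)
  · intro x
    have : S'.starProjection (e.symm x) ∈ S' := Submodule.starProjection_apply_mem _ _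
    exact this
  · intro x hx
    have : S'.starProjection (e.symm x) = e.symm x := by
      rw [Submodule.starProjection_eq_self_iff]
      change e (e.symm x) ∈ S
      simpa using hx
    change e (S'.starProjection (e.symm x)) = x
    rw [this]
    simp

/-- The dimension of the intersection of two subspaces is upper semicontinuous. -/
lemma eventually_finrank_map_inf_le (A B : Submodule ℂ (Fin n → ℂ)) :
    ∀ᶠ x in 𝓝 (1 : Endo n),
      Module.finrank ℂ ↥(A.map x.toLinearMap ⊓ B) ≤ Module.finrank ℂ ↥(A ⊓ B) := by
  -- `x A ∩ B` is the image of the kernel of `T x = (1 - p) x : A → ℂⁿ`, where `p` is a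
  -- projection onto `B`, and the rank of `T x` is lower semicontinuous.
  obtain ⟨C, hC⟩ := exists_bounded_isProj n
  obtain ⟨p, -, hp⟩ := hC B
  have hpB : ∀ v, (1 - p) v = 0 ↔ v ∈ B := fun v =>
    ⟨fun h => (sub_eq_zero.1 h : v = p v) ▸ hp.map_mem v,
      fun h => sub_eq_zero.2 (hp.map_id v h).symm⟩
  let T : Endo n → (A →L[ℂ] (Fin n → ℂ)) := fun x => (1 - p).comp (x.comp A.subtypeL)
  have hT : Continuous T := by fun_prop
  have hker : ∀ x, A.map x.toLinearMap ⊓ B ≤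
      (LinearMap.ker (T x).toLinearMap).map (x.toLinearMap ∘ₗ A.subtype) := by
    rintro x _ ⟨⟨v, hv, rfl⟩, hB⟩
    exact ⟨⟨v, hv⟩, (hpB _).2 hB, rfl⟩
  have hker1 : Module.finrank ℂ (LinearMap.ker (T 1).toLinearMap) ≤
      Module.finrank ℂ ↥(A ⊓ B) := by
    rw [← Submodule.finrank_map_subtype_eq]
    refine Submodule.finrank_mono ?_
    rintro _ ⟨v, hv, rfl⟩
    exact ⟨v.2, (hpB _).1 hv⟩
  have hopen := (isOpen_setOfPred_nat_le_rank (𝕜 := ℂ) (E := A) (F := Fin n → ℂ)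
    (Module.finrank ℂ (LinearMap.range (T 1).toLinearMap))).preimage hT
  have hmem : (1 : Endo n) ∈ T ⁻¹' {f |
      (Module.finrank ℂ (LinearMap.range (T 1).toLinearMap) : Cardinal) ≤
        f.toLinearMap.rank} := by
    rw [Set.mem_preimage, Set.mem_ofPred_eq]
    rw [LinearMap.rank, Module.finrank_eq_rank]
  filter_upwards [hopen.mem_nhds hmem] with x hx
  rw [Set.mem_preimage, Set.mem_ofPred_eq] at hx
  rw [LinearMap.rank, ← Module.finrank_eq_rank, Nat.cast_le] at hx
  have h1 := LinearMap.finrank_range_add_finrank_ker (T x).toLinearMap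
  have h2 := LinearMap.finrank_range_add_finrank_ker (T 1).toLinearMap
  have h3 := (Submodule.finrank_mono (hker x)).trans (Submodule.finrank_map_le _ _)
  omega

/-- Schubert varieties are closed: `E` lies in a Schubert variety if arbitrarily small
translates of it do. -/
lemma mem_schubertVariety_of_tendsto {σ : Equiv.Perm (Fin n)}
    {F : Fin (n + 1) → Submodule ℂ (Fin n → ℂ)} {E : α → Submodule ℂ (Fin n → ℂ)}
    {x : ℕ → Endo n} (hx : Filter.Tendsto x Filter.atTop (𝓝 1))
    (hE : ∀ᶠ k in Filter.atTop, translateFlag (x k) E ∈ schubertVariety α σ F) :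
    E ∈ schubertVariety α σ F := by
  refine ⟨?_, fun a j => ?_⟩
  · obtain ⟨k, hk, hk'⟩ := (hE.and (hx.eventually eventually_isUnit)).exists
    exact (translateFlag_mem_flagManifold_iff hk').1 hk.1
  · obtain ⟨k, hk, hk'⟩ :=
      (hE.and (hx.eventually (eventually_finrank_map_inf_le (E a) (F j)))).exists
    exact (hk.2 a j).trans hk'

/-- If projections onto nested subspaces converge, then the nested subspaces converge, in the
sense that they are translates of the limit by endomorphisms that converge to the identity. -/
lemma exists_tendsto_one_of_isProj {E : ℕ → Submodule ℂ (Fin n → ℂ)}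
    {E' : ℕ → ℕ → Submodule ℂ (Fin n → ℂ)} {p : ℕ → Endo n} {p' : ℕ → ℕ → Endo n}
    (s : Finset ℕ) (hE : ∀ a ∈ s, ∀ b ∈ s, a ≤ b → E a ≤ E b)
    (hE' : ∀ k, ∀ a ∈ s, ∀ b ∈ s, a ≤ b → E' k a ≤ E' k b)
    (hp : ∀ a ∈ s, LinearMap.IsProj (E a) (p a))
    (hp' : ∀ k, ∀ a ∈ s, LinearMap.IsProj (E' k a) (p' k a))
    (hlim : ∀ a ∈ s, Filter.Tendsto (fun k => p' k a) Filter.atTop (𝓝 (p a))) :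
    ∃ h : ℕ → Endo n, Filter.Tendsto h Filter.atTop (𝓝 1) ∧
      ∀ k, ∀ a ∈ s, ∀ x ∈ E a, h k x ∈ E' k a := by
  induction s using Finset.induction_on_max with
  | empty => exact ⟨fun _ => 1, tendsto_const_nhds, by simp⟩
  | insert b s hb ih =>
    obtain ⟨h, hh, hmap⟩ := ih
      (fun a ha c hc => hE a (Finset.mem_insert_of_mem ha) c (Finset.mem_insert_of_mem hc))
      (fun k a ha c hc => hE' k a (Finset.mem_insert_of_mem ha) c (Finset.mem_insert_of_mem hc))
      (fun a ha => hp a (Finset.mem_insert_of_mem ha))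
      (fun k a ha => hp' k a (Finset.mem_insert_of_mem ha))
      (fun a ha => hlim a (Finset.mem_insert_of_mem ha))
    have hbm := Finset.mem_insert_self b s
    have hpb : p b * p b = p b :=
      ContinuousLinearMap.ext fun x => (hp b hbm).map_id _ ((hp b hbm).map_mem x)
    -- On `E b` this agrees with `p'_b h`, which on the smaller subspaces agrees with `h`.
    refine ⟨fun k => p' k b * h k * p b + (1 - p' k b) * (1 - p b), ?_, ?_⟩
    · have h1 := (((hlim b hbm).mul hh).mul_const (p b)).add
        (((tendsto_const_nhds (x := (1 : Endo n))).sub (hlim b hbm)).mul_const (1 - p b))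
      have h2 : p b * 1 * p b + (1 - p b) * (1 - p b) = 1 := by
        simp [sub_mul, mul_sub, hpb]
      rwa [h2] at h1
    · intro k a ha x hx
      have hxb : x ∈ E b := hE a ha b hbm
        ((Finset.mem_insert.1 ha).elim (fun h => h.le) fun h => (hb a h).le) hx
      have hval : (p' k b * h k * p b + (1 - p' k b) * (1 - p b)) x = p' k b (h k x) := by
        simp [(hp b hbm).map_id x hxb]
      rw [hval]
      obtain rfl | ha' := Finset.mem_insert.1 ha
      · exact (hp' k a hbm).map_mem _
      · have h1 := hmap k a ha' x hx
        rw [(hp' k b hbm).map_id _ (hE' k a ha b hbm (hb a ha').le h1)]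
        exact h1

/-- The flag manifold is compact. Convergence of flags is expressed by translations that converge
to the identity. -/
lemma exists_subseq_tendsto_flag {E' : ℕ → α → Submodule ℂ (Fin n → ℂ)}
    (hE' : ∀ k, E' k ∈ flagManifold n α) :
    ∃ φ : ℕ → ℕ, StrictMono φ ∧ ∃ E ∈ flagManifold n α, ∃ h : ℕ → Endo n,
      Filter.Tendsto h Filter.atTop (𝓝 1) ∧
        ∀ᶠ k in Filter.atTop, E' (φ k) = translateFlag (h k) E := by
  obtain ⟨C, hC⟩ := exists_bounded_isProj n
  choose p' hp'C hp' using fun k a => hC (E' k a)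
  have hbdd : Bornology.IsBounded (Set.pi Set.univ fun _ : α => Metric.closedBall (0 : Endo n) C) :=
    Bornology.IsBounded.pi fun _ => Metric.isBounded_closedBall
  have : ProperSpace (Endo n) := FiniteDimensional.proper ℂ _
  obtain ⟨p, -, φ, hφ, hlim⟩ := tendsto_subseq_of_bounded hbdd (x := p')
    (fun k a _ => by simpa using hp'C k a)
  rw [tendsto_pi_nhds] at hlim
  have hid : ∀ a b : α, a ≤ b → p b * p a = p a := by
    intro a b hab
    refine tendsto_nhds_unique (((hlim b).mul (hlim a)).congr fun k => ?_) (hlim a)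
    exact ContinuousLinearMap.ext fun x =>
      (hp' (φ k) b).map_id _ ((hE' (φ k)).1 hab ((hp' (φ k) a).map_mem x))
  have hproj : ∀ a, LinearMap.IsProj (LinearMap.range (p a).toLinearMap) (p a) := by
    refine fun a => ⟨fun x => ⟨x, rfl⟩, ?_⟩
    rintro _ ⟨x, rfl⟩
    exact congrArg (fun f : Endo n => f x) (hid a a le_rfl)
  -- The dimension of the image of a projection is its trace, hence passes to the limit.
  let tr : Endo n →ₗ[ℂ] ℂ := LinearMap.trace ℂ (Fin n → ℂ) ∘ₗ
    (LinearMap.toContinuousLinearMap (𝕜 := ℂ) (E := Fin n → ℂ) (F' := Fin n → ℂ)).symm.toLinearMap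
  have htr : ∀ {S : Submodule ℂ (Fin n → ℂ)} {f : Endo n}, LinearMap.IsProj S f →
      tr f = (Module.finrank ℂ S : ℂ) := fun {S f} hf =>
    LinearMap.IsProj.trace (p := S) (f := f.toLinearMap) ⟨hf.map_mem, hf.map_id⟩
  have hE : (fun a : α => LinearMap.range (p a).toLinearMap) ∈ flagManifold n α := by
    refine ⟨?_, fun a => ?_⟩
    · rintro a b hab _ ⟨x, rfl⟩
      exact ⟨p a x, congrArg (fun f : Endo n => f x) (hid a b hab)⟩
    · have h1 := ((LinearMap.continuous_of_finiteDimensional tr).tendsto _).comp (hlim a)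
      have h2 : (tr ∘ fun k => (p' ∘ φ) k a) = fun _ => ((a : ℕ) : ℂ) := by
        funext k
        change tr (p' (φ k) a) = _
        rw [htr (hp' (φ k) a), (hE' (φ k)).2]
      rw [h2] at h1
      have h3 := tendsto_nhds_unique h1 tendsto_const_nhds
      rw [htr (hproj a)] at h3
      exact_mod_cast h3
  refine ⟨φ, hφ, _, hE, ?_⟩
  obtain ⟨h, hh, hmap⟩ := exists_tendsto_one_of_isProj
    (E := fun a => if ha : a ∈ α then LinearMap.range (p ⟨a, ha⟩).toLinearMap else ⊥)
    (E' := fun k a => if ha : a ∈ α then E' (φ k) ⟨a, ha⟩ else ⊥)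
    (p := fun a => if ha : a ∈ α then p ⟨a, ha⟩ else 0)
    (p' := fun k a => if ha : a ∈ α then p' (φ k) ⟨a, ha⟩ else 0) α
    (fun a ha b hb hab => by simpa [ha, hb] using hE.1 (show (⟨a, ha⟩ : α) ≤ ⟨b, hb⟩ from hab))
    (fun k a ha b hb hab => by
      simpa [ha, hb] using (hE' (φ k)).1 (show (⟨a, ha⟩ : α) ≤ ⟨b, hb⟩ from hab))
    (fun a ha => by simpa only [ha, dif_pos] using hproj ⟨a, ha⟩)
    (fun k a ha => by simpa only [ha, dif_pos] using hp' (φ k) ⟨a, ha⟩)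
    (fun a ha => by simpa only [ha, dif_pos, Function.comp_apply] using hlim ⟨a, ha⟩)
  refine ⟨h, hh, ?_⟩
  filter_upwards [hh.eventually eventually_isUnit] with k hk
  funext a
  refine (Submodule.eq_of_le_of_finrank_le ?_ ?_).symm
  · rintro _ ⟨x, hx, rfl⟩
    have := hmap k a a.2 x (by rwa [dif_pos a.2])
    rwa [dif_pos a.2] at this
  · rw [translateFlag, finrank_map_of_isUnit hk, hE.2, (hE' _).2]

/-! ### The stabilizer of a flag and slices of its orbit map -/

/-- The endomorphisms of `ℂⁿ` that preserve the flag `E`. -/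
def flagStabilizer (E : α → Submodule ℂ (Fin n → ℂ)) : Submodule ℂ (Endo n) where
  carrier := {h | ∀ a, ∀ x ∈ E a, h x ∈ E a}
  add_mem' hg hh a x hx := (E a).add_mem (hg a x hx) (hh a x hx)
  zero_mem' a _ _ := (E a).zero_mem
  smul_mem' c _ hh a x hx := (E a).smul_mem c (hh a x hx)

lemma translateFlag_eq_self {E : α → Submodule ℂ (Fin n → ℂ)} {g : Endo n} (hg : IsUnit g)
    (h : g ∈ flagStabilizer E) : translateFlag g E = E :=
  funext fun a => Submodule.eq_of_le_of_finrank_le (Submodule.map_le_iff_le_comap.2 (h a))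
    (finrank_map_of_isUnit hg (E a)).ge

lemma one_add_mem_flagStabilizer {E : α → Submodule ℂ (Fin n → ℂ)} {p : Endo n}
    (hp : p ∈ flagStabilizer E) : 1 + p ∈ flagStabilizer E :=
  (flagStabilizer E).add_mem (fun _ _ hx => hx) hp

/-- The orbit map identifies the tangent space of the flag manifold at `E` with the quotient of
`End(ℂⁿ)` by the stabilizer of `E`; its dimension is at most `dim(α)`. -/
lemma finrank_quotient_flagStabilizer_le {E : α → Submodule ℂ (Fin n → ℂ)}
    (hE : E ∈ flagManifold n α) :
    Module.finrank ℂ (Endo n ⧸ flagStabilizer E) ≤ flagDim n α := by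
  let pred : ℕ → ℕ := fun a => (α.filter (· < a)).sup id
  let E0 : ℕ → Submodule ℂ (Fin n → ℂ) := fun j => if h : j ∈ α then E ⟨j, h⟩ else ⊥
  have hpred : ∀ a : α, pred a = 0 ∨ (pred a ∈ α ∧ pred a < a) := by
    intro a
    rcases (α.filter (· < (a : ℕ))).eq_empty_or_nonempty with h | h
    · left; simp [pred, h]
    · right
      obtain ⟨b, hb, hb'⟩ := Finset.exists_mem_eq_sup _ h id
      rw [Finset.mem_filter] at hb
      simp only [pred, hb', id]
      exact hb
  have hE0_le : ∀ a : α, E0 (pred a) ≤ E a := by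
    intro a
    by_cases h : pred a ∈ α
    · simp only [E0, h, dif_pos]
      refine hE.1 ?_
      rcases hpred a with h0 | h0
      · exact Subtype.mk_le_mk.2 (by omega)
      · exact Subtype.mk_le_mk.2 h0.2.le
    · simp only [E0, h, dif_neg, not_false_iff, bot_le]
  have hE0_dim : ∀ a : α, Module.finrank ℂ (E0 (pred a)) = pred a := by
    intro a
    by_cases h : pred a ∈ α
    · have h1 : E0 (pred a) = E ⟨pred a, h⟩ := dif_pos h
      rw [h1]
      exact hE.2 _
    · have h1 : E0 (pred a) = ⊥ := dif_neg h
      rw [h1, finrank_bot]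
      rcases hpred a with h0 | h0
      · exact h0.symm
      · exact absurd h0.1 h
  -- `C a` is a complement in `E a` of the preceding subspace of the flag.
  have hC : ∀ a : α, ∃ C : Submodule ℂ (Fin n → ℂ), C ⊔ E0 (pred a) = E a ∧
      Module.finrank ℂ C = a - pred a := by
    intro a
    obtain ⟨C, hC⟩ := Submodule.exists_isCompl ((E0 (pred a)).comap (E a).subtype)
    have hmap : ((E0 (pred a)).comap (E a).subtype).map (E a).subtype = E0 (pred a) := by
      rw [Submodule.map_comap_subtype]
      exact inf_eq_right.2 (hE0_le a)
    refine ⟨C.map (E a).subtype, ?_, ?_⟩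
    · rw [← hmap, ← Submodule.map_sup, sup_comm, hC.sup_eq_top, Submodule.map_subtype_top]
    · have h1 := Submodule.finrank_add_eq_of_isCompl hC
      rw [← Submodule.finrank_map_subtype_eq, hmap, hE0_dim, hE.2,
        ← Submodule.finrank_map_subtype_eq (E a) C] at h1
      omega
  choose C hCsup hCdim using hC
  let Ψ : Endo n →ₗ[ℂ] ((a : α) → (C a →ₗ[ℂ] (Fin n → ℂ) ⧸ E a)) :=
    LinearMap.pi fun a =>
      { toFun := fun h => (E a).mkQ ∘ₗ h.toLinearMap ∘ₗ (C a).subtype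
        map_add' := fun g h => by ext x; simp
        map_smul' := fun c h => by ext x; simp }
  have hker : LinearMap.ker Ψ ≤ flagStabilizer E := by
    intro h hh
    have hmem : ∀ a : α, ∀ x ∈ C a, h x ∈ E a := fun a x hx =>
      (Submodule.Quotient.mk_eq_zero (E a)).1
        (LinearMap.congr_fun (congrFun (LinearMap.mem_ker.1 hh) a) ⟨x, hx⟩)
    have hind : ∀ k : ℕ, ∀ a : α, (a : ℕ) = k → E a ≤ (E a).comap h.toLinearMap := by
      intro k
      induction k using Nat.strong_induction_on with
      | _ k ih =>
        intro a ha
        refine (hCsup a).ge.trans (sup_le (hmem a) ?_)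
        by_cases hp : pred a ∈ α
        · rcases (hpred a) with h0 | h0
          · have hbot : E0 (pred a) = ⊥ := by
              rw [← Submodule.finrank_eq_zero, hE0_dim, h0]
            rw [hbot]
            exact bot_le
          · have h1 := ih (pred a) (ha ▸ h0.2) ⟨pred a, hp⟩ rfl
            have h2 := hE0_le a
            simp only [E0, hp, dif_pos] at h2 ⊢
            exact h1.trans (Submodule.comap_mono h2)
        · simp only [E0, hp, dif_neg, not_false_iff, bot_le]
    exact fun a => hind a a rfl
  have h1 := LinearMap.finrank_range_add_finrank_ker Ψ
  have h2 := Submodule.finrank_quotient_add_finrank (flagStabilizer E)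
  have h3 := Submodule.finrank_mono hker
  have h4 := Submodule.finrank_le (LinearMap.range Ψ)
  have h5 : Module.finrank ℂ ((a : α) → (C a →ₗ[ℂ] (Fin n → ℂ) ⧸ E a)) = flagDim n α := by
    refine (Module.finrank_pi_fintype ℂ).trans (Eq.trans ?_
      (Finset.sum_coe_sort α fun a => (n - a) * (a - pred a)))
    refine Finset.sum_congr rfl fun a _ => ?_
    have h6 := Submodule.finrank_quotient_add_finrank (E a)
    rw [hE.2, Module.finrank_fin_fun] at h6
    rw [Module.finrank_linearMap, hCdim, mul_comm]
    congr 1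
    omega
  omega

lemma hasStrictFDerivAt_mul_of_eq_one {R A : Type*} [NormedRing R] [NormedAlgebra ℂ R]
    [NormedAddCommGroup A] [NormedSpace ℂ A] {f g : A → R} {f' g' : A →L[ℂ] R} {x : A}
    (hf : HasStrictFDerivAt f f' x) (hg : HasStrictFDerivAt g g' x) (hfx : f x = 1)
    (hgx : g x = 1) : HasStrictFDerivAt (fun y => f y * g y) (f' + g') x := by
  refine (hf.mul' hg).congr_fderiv (ContinuousLinearMap.ext fun z => ?_)
  simp [hfx, hgx, add_comm]

/-- Near the identity, the flags `h E` are exhausted by those with `h - 1` in a complement of the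
stabilizer of `E`. -/
lemma exists_slice (E : α → Submodule ℂ (Fin n → ℂ)) {V : Submodule ℂ (Endo n)}
    (hV : V ⊔ flagStabilizer E = ⊤) {U : Set (Endo n)} (hU : U ∈ 𝓝 1) :
    ∀ᶠ h in 𝓝 (1 : Endo n), ∃ v ∈ V, 1 + v ∈ U ∧
      translateFlag h E = translateFlag (1 + v) E := by
  set P := flagStabilizer E
  let ψ : V × P → Endo n := fun z => (1 + (z.1 : Endo n)) * (1 + (z.2 : Endo n))
  let ψ' : V × P →L[ℂ] Endo n := V.subtypeL.comp (ContinuousLinearMap.fst ℂ V P) +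
    P.subtypeL.comp (ContinuousLinearMap.snd ℂ V P)
  have h1 : HasStrictFDerivAt (fun z : V × P => (1 : Endo n) + z.1)
      (V.subtypeL.comp (ContinuousLinearMap.fst ℂ V P)) 0 :=
    ((V.subtypeL.comp (ContinuousLinearMap.fst ℂ V P)).hasStrictFDerivAt).const_add (1 : Endo n)
  have h2 : HasStrictFDerivAt (fun z : V × P => (1 : Endo n) + z.2)
      (P.subtypeL.comp (ContinuousLinearMap.snd ℂ V P)) 0 :=
    ((P.subtypeL.comp (ContinuousLinearMap.snd ℂ V P)).hasStrictFDerivAt).const_add (1 : Endo n)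
  have hψ : HasStrictFDerivAt ψ ψ' 0 := by
    exact hasStrictFDerivAt_mul_of_eq_one h1 h2 (by simp) (by simp)
  have hsurj : ψ'.range = ⊤ := by
    rw [eq_top_iff, ← hV]
    exact sup_le (fun v hv => ⟨(⟨v, hv⟩, 0), by simp [ψ']⟩) fun p hp => ⟨(0, ⟨p, hp⟩), by simp [ψ']⟩
  have hmap := hψ.map_nhds_eq_of_surj hsurj
  have hψ0 : ψ 0 = 1 := by simp [ψ]
  rw [hψ0] at hmap
  rw [← hmap, Filter.eventually_map]
  have ev1 : ∀ᶠ z : V × P in 𝓝 0, 1 + (z.1 : Endo n) ∈ U := by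
    refine h1.continuousAt.eventually_mem ?_
    simpa using hU
  have ev2 : ∀ᶠ z : V × P in 𝓝 0, IsUnit (1 + (z.2 : Endo n)) := by
    refine h2.continuousAt.eventually (p := fun x => IsUnit x) ?_
    simpa using eventually_isUnit
  filter_upwards [ev1, ev2] with z hz1 hz2
  refine ⟨z.1, z.1.2, hz1, ?_⟩
  rw [translateFlag_mul, translateFlag_eq_self hz2 (one_add_mem_flagStabilizer z.2.2)]

/-! ### Local equations and isolated points -/

/-- The preimage of `X` under the orbit map `h ↦ h E` is, near `h = 1`, the zero set of the
analytic map `f`. -/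
structure IsLocalEquation (X : Set (α → Submodule ℂ (Fin n → ℂ)))
    (E : α → Submodule ℂ (Fin n → ℂ)) {c : ℕ} (f : Endo n → Fin c → ℂ) : Prop where
  analyticAt : AnalyticAt ℂ f 1
  mem_iff : ∀ᶠ h in 𝓝 (1 : Endo n), translateFlag h E ∈ X ↔ f h = 0

/-- The equation `f` vanishes along `1 + z p` for `p` in the stabilizer of a point `E` of `X`,
because `(1 + z p) E = E`. -/
lemma IsLocalEquation.stabilizer_le_ker {X : Set (α → Submodule ℂ (Fin n → ℂ))}
    {E : α → Submodule ℂ (Fin n → ℂ)} {c : ℕ} {f : Endo n → Fin c → ℂ}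
    (hf : IsLocalEquation X E f) (hE : E ∈ X) :
    flagStabilizer E ≤ LinearMap.ker (fderiv ℂ f 1).toLinearMap := by
  intro p hp
  have hline : HasDerivAt (fun z : ℂ => 1 + z • p) p 0 := by
    simpa using ((hasDerivAt_id (0 : ℂ)).smul_const p).const_add (1 : Endo n)
  have h0 : (1 : Endo n) + (0 : ℂ) • p = 1 := by simp
  have hcomp : HasDerivAt (fun z : ℂ => f (1 + z • p)) (fderiv ℂ f 1 p) 0 := by
    refine HasFDerivAt.comp_hasDerivAt (f := fun z : ℂ => 1 + z • p) (l := f) 0 ?_ hline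
    rw [h0]
    exact hf.analyticAt.differentiableAt.hasFDerivAt
  have htend : Filter.Tendsto (fun z : ℂ => 1 + z • p) (𝓝 0) (𝓝 1) := by
    simpa [ContinuousAt, h0] using hline.continuousAt
  have hzero : (fun z : ℂ => f (1 + z • p)) =ᶠ[𝓝 0] fun _ => 0 := by
    filter_upwards [htend.eventually hf.mem_iff, htend.eventually eventually_isUnit] with z hz hu
    rw [← hz, translateFlag_eq_self hu
      (one_add_mem_flagStabilizer ((flagStabilizer E).smul_mem z hp))]
    exact hE
  exact hcomp.unique ((hasDerivAt_const (0 : ℂ) (0 : Fin c → ℂ)).congr_of_eventuallyEq hzero)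

variable {c : Fin m → ℕ}

/-- The joint differential at the identity of the equations `f_1, …, f_m`. -/
noncomputable def jointDeriv (f : ∀ i, Endo n → Fin (c i) → ℂ) :
    Endo n →L[ℂ] ((i : Fin m) → Fin (c i) → ℂ) :=
  ContinuousLinearMap.pi fun i => fderiv ℂ (f i) 1

lemma finrank_pi_fin (c : Fin m → ℕ) :
    Module.finrank ℂ ((i : Fin m) → Fin (c i) → ℂ) = ∑ i, c i := by
  simp [Module.finrank_pi_fintype]

/-- At a transverse point, when the codimensions add up to the dimension of the flag manifold, the
tangent spaces intersect only in the stabilizer of `E`, i.e. in the tangent vector zero. -/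
lemma ker_jointDeriv_eq {X : Fin m → Set (α → Submodule ℂ (Fin n → ℂ))}
    {E : α → Submodule ℂ (Fin n → ℂ)} {f : ∀ i, Endo n → Fin (c i) → ℂ}
    (hf : ∀ i, IsLocalEquation (X i) E (f i)) (hEX : ∀ i, E ∈ X i) (hE : E ∈ flagManifold n α)
    (hsurj : Function.Surjective (jointDeriv f)) (hc : ∑ i, c i = flagDim n α) :
    LinearMap.ker (jointDeriv f).toLinearMap = flagStabilizer E := by
  have hle : flagStabilizer E ≤ LinearMap.ker (jointDeriv f).toLinearMap := fun p hp =>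
    funext fun i => (hf i).stabilizer_le_ker (hEX i) hp
  refine (Submodule.eq_of_le_of_finrank_le hle ?_).symm
  have h1 := LinearMap.finrank_range_add_finrank_ker (jointDeriv f).toLinearMap
  rw [LinearMap.range_eq_top.2 hsurj, finrank_top, finrank_pi_fin, hc] at h1
  have h2 := Submodule.finrank_quotient_add_finrank (flagStabilizer E)
  have h3 := finrank_quotient_flagStabilizer_le hE
  omega

/-- A transverse point is isolated, uniformly in the Schubert varieties: if these are moved by
endomorphisms `q_i` close to the identity, there is at most one point of the intersection
near `E`. -/
lemma exists_nhds_unique {X : Fin m → Set (α → Submodule ℂ (Fin n → ℂ))}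
    {E : α → Submodule ℂ (Fin n → ℂ)} {f : ∀ i, Endo n → Fin (c i) → ℂ}
    (hf : ∀ i, IsLocalEquation (X i) E (f i))
    (hker : LinearMap.ker (jointDeriv f).toLinearMap = flagStabilizer E) :
    ∃ S ∈ 𝓝 (1 : Fin m → Endo n), ∃ U ∈ 𝓝 (1 : Endo n), ∀ q ∈ S, ∀ h ∈ U, ∀ h' ∈ U,
      (∀ i, translateFlag (q i) (translateFlag h E) ∈ X i) →
      (∀ i, translateFlag (q i) (translateFlag h' E) ∈ X i) →
      translateFlag h E = translateFlag h' E := by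
  obtain ⟨V, hV⟩ := Submodule.exists_isCompl (flagStabilizer E)
  -- The equations of the moved varieties, jointly in `q` and in `h`.
  let Φ : (Fin m → Endo n) × Endo n → ((i : Fin m) → Fin (c i) → ℂ) :=
    fun z i => f i (z.1 i * z.2)
  let A : Fin m → ((Fin m → Endo n) × Endo n →L[ℂ] Endo n) := fun i =>
    (ContinuousLinearMap.proj i).comp (ContinuousLinearMap.fst ℂ (Fin m → Endo n) (Endo n)) +
      ContinuousLinearMap.snd ℂ (Fin m → Endo n) (Endo n)
  let Φ' : (Fin m → Endo n) × Endo n →L[ℂ] ((i : Fin m) → Fin (c i) → ℂ) :=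
    ContinuousLinearMap.pi fun i => (fderiv ℂ (f i) 1).comp (A i)
  have hmul : ∀ i,
      HasStrictFDerivAt (fun z : (Fin m → Endo n) × Endo n => z.1 i * z.2) (A i) 1 := by
    intro i
    have h1 : HasStrictFDerivAt (fun z : (Fin m → Endo n) × Endo n => z.1 i)
        ((ContinuousLinearMap.proj i).comp
          (ContinuousLinearMap.fst ℂ (Fin m → Endo n) (Endo n))) 1 :=
      ((ContinuousLinearMap.proj (R := ℂ) (φ := fun _ : Fin m => Endo n) i).comp
        (ContinuousLinearMap.fst ℂ (Fin m → Endo n) (Endo n))).hasStrictFDerivAt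
    have h2 : HasStrictFDerivAt (fun z : (Fin m → Endo n) × Endo n => z.2)
        (ContinuousLinearMap.snd ℂ (Fin m → Endo n) (Endo n)) 1 :=
      (ContinuousLinearMap.snd ℂ (Fin m → Endo n) (Endo n)).hasStrictFDerivAt
    exact hasStrictFDerivAt_mul_of_eq_one h1 h2 rfl rfl
  have h11 : ∀ i, (1 : (Fin m → Endo n) × Endo n).1 i * (1 : (Fin m → Endo n) × Endo n).2 = 1 :=
    fun i => by simp
  have hΦ : HasStrictFDerivAt Φ Φ' 1 := by
    rw [hasStrictFDerivAt_pi']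
    intro i
    refine HasStrictFDerivAt.comp (g := f i) 1 ?_ (hmul i)
    rw [h11]
    exact (hf i).analyticAt.hasStrictFDerivAt
  have hmem : ∀ᶠ z in 𝓝 (1 : (Fin m → Endo n) × Endo n), ∀ i,
      translateFlag (z.1 i * z.2) E ∈ X i ↔ Φ z i = 0 := by
    rw [Filter.eventually_all]
    intro i
    refine (hmul i).continuousAt.eventually
      (p := fun x => translateFlag x E ∈ X i ↔ f i x = 0) ?_
    beta_reduce
    rw [h11]
    exact (hf i).mem_iff
  -- The joint differential is injective on the slice `V`.
  let DV : V →ₗ[ℂ] ((i : Fin m) → Fin (c i) → ℂ) := (jointDeriv f).toLinearMap ∘ₗ V.subtype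
  have hDV : LinearMap.ker DV = ⊥ := by
    rw [eq_bot_iff]
    intro v hv
    have h1 : (v : Endo n) ∈ flagStabilizer E := by
      rw [← hker]
      exact hv
    exact Subtype.ext ((Submodule.disjoint_def.1 hV.disjoint) _ h1 v.2)
  -- Distances on `V` shrink by at most the factor `K` under the differential; the equations deviate
  -- from it by at most half of that, so they too are injective.
  obtain ⟨K, hK, hanti⟩ := LinearMap.exists_antilipschitzWith DV hDV
  have hcpos : 0 < (2 * K)⁻¹ := by positivity
  obtain ⟨s, hs, happ⟩ := hΦ.approximates_deriv_on_nhds (c := (2 * K)⁻¹) (Or.inr hcpos)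
  obtain ⟨S, hS, U₀, hU₀, hSU⟩ := mem_nhds_prod_iff.1 (Filter.inter_mem hs hmem)
  refine ⟨S, hS, _, exists_slice E (sup_comm _ V ▸ hV.sup_eq_top) hU₀, ?_⟩
  rintro q hq h ⟨v, hv, hvU, hvh⟩ h' ⟨v', hv', hvU', hvh'⟩ hX hX'
  rw [hvh] at hX ⊢
  rw [hvh'] at hX' ⊢
  have hz := hSU (Set.mk_mem_prod hq hvU)
  have hz' := hSU (Set.mk_mem_prod hq hvU')
  have hΦ0 : Φ (q, 1 + v) = 0 := funext fun i => (hz.2 i).1 (by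
    simpa only [translateFlag_mul] using hX i)
  have hΦ0' : Φ (q, 1 + v') = 0 := funext fun i => (hz'.2 i).1 (by
    simpa only [translateFlag_mul] using hX' i)
  have hest := happ _ hz.1 _ hz'.1
  have hdiff : ((q, 1 + v) : (Fin m → Endo n) × Endo n) - (q, 1 + v') = (0, v - v') := by
    ext1 <;> simp
  have hΦ'v : Φ' (0, v - v') = DV (⟨v, hv⟩ - ⟨v', hv'⟩) := by
    funext i
    simp [Φ', A, DV, jointDeriv]
  rw [hΦ0, hΦ0', hdiff, hΦ'v, sub_zero, zero_sub, norm_neg, Prod.norm_mk, norm_zero,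
    max_eq_right (norm_nonneg _)] at hest
  have hlow := hanti.le_mul_dist ⟨v, hv⟩ ⟨v', hv'⟩
  rw [dist_eq_norm, dist_eq_norm, ← map_sub] at hlow
  have hnorm : ‖(⟨v, hv⟩ : V) - ⟨v', hv'⟩‖ = ‖v - v'‖ := rfl
  rw [hnorm] at hlow
  have hKpos : (0 : ℝ) < K := hK
  have hle : ‖v - v'‖ ≤ 1 / 2 * ‖v - v'‖ := by
    calc ‖v - v'‖ ≤ K * ‖DV (⟨v, hv⟩ - ⟨v', hv'⟩)‖ := hlow
      _ ≤ K * (((2 * K)⁻¹ : NNReal) * ‖v - v'‖) := by gcongr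
      _ = 1 / 2 * ‖v - v'‖ := by push_cast; field_simp
  have hvv : v = v' := by
    rw [← sub_eq_zero, ← norm_eq_zero]
    linarith [norm_nonneg (v - v')]
  rw [hvv]

/-! ### Openness of transversality -/

lemma isOpen_setOf_surjective_clm {A B : Type*} [NormedAddCommGroup A] [NormedSpace ℂ A]
    [NormedAddCommGroup B] [NormedSpace ℂ B] [FiniteDimensional ℂ B] :
    IsOpen {f : A →L[ℂ] B | Function.Surjective f} := by
  have h := isOpen_setOfPred_nat_le_rank (𝕜 := ℂ) (E := A) (F := B) (Module.finrank ℂ B)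
  convert h using 2
  ext f
  constructor
  · intro hf
    change Module.finrank ℂ B ≤ Module.rank ℂ (LinearMap.range f.toLinearMap)
    rw [LinearMap.range_eq_top.2 hf, rank_top, Module.finrank_eq_rank]
  · intro hf
    change Module.finrank ℂ B ≤ Module.rank ℂ (LinearMap.range f.toLinearMap) at hf
    rw [← Module.finrank_eq_rank, Nat.cast_le] at hf
    exact LinearMap.range_eq_top.1
      (Submodule.eq_top_of_finrank_eq (le_antisymm (Submodule.finrank_le _) hf))

lemma finrank_quotient_ker {A B : Type*} [AddCommGroup A] [Module ℂ A] [AddCommGroup B]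
    [Module ℂ B] {f : A →ₗ[ℂ] B} (hf : Function.Surjective f) :
    Module.finrank ℂ (A ⧸ LinearMap.ker f) = Module.finrank ℂ B :=
  (f.quotKerEquivOfSurjective hf).finrank_eq

/-- Transversality is an open condition: it persists at the points of the intersection near `E`
if the Schubert varieties are moved by endomorphisms `q_i` close to the identity. -/
lemma exists_nhds_transverse {X : Fin m → Set (α → Submodule ℂ (Fin n → ℂ))}
    {E : α → Submodule ℂ (Fin n → ℂ)} {f : ∀ i, Endo n → Fin (c i) → ℂ}
    (hf : ∀ i, IsLocalEquation (X i) E (f i))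
    (hsurj : Function.Surjective (jointDeriv f)) :
    ∃ S ∈ 𝓝 (1 : Fin m → Endo n), ∃ U ∈ 𝓝 (1 : Endo n), ∀ q ∈ S, ∀ h ∈ U,
      ∀ Y : Fin m → Set (α → Submodule ℂ (Fin n → ℂ)),
        (∀ i E', E' ∈ Y i ↔ translateFlag (q i) E' ∈ X i) →
        ∃ T : Fin m → Submodule ℂ (Endo n),
          (∀ i, IsSmoothAt (Y i) (translateFlag h E) (c i) (T i)) ∧
          Module.finrank ℂ (Endo n ⧸ (⨅ i, T i)) = ∑ i, Module.finrank ℂ (Endo n ⧸ T i) := by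
  -- The translate of `Y i` to `h E` has the equation `f i (q i * (x * h))` in `x`.
  let M : Endo n → Endo n → (Endo n →L[ℂ] Endo n) := fun q h =>
    (ContinuousLinearMap.mul ℂ (Endo n) q).comp ((ContinuousLinearMap.mul ℂ (Endo n)).flip h)
  let D : (Fin m → Endo n) × Endo n → (Endo n →L[ℂ] ((i : Fin m) → Fin (c i) → ℂ)) := fun z =>
    ContinuousLinearMap.pi fun i => (fderiv ℂ (f i) (z.1 i * z.2)).comp (M (z.1 i) z.2)
  have hmul : ∀ i, Filter.Tendsto (fun z : (Fin m → Endo n) × Endo n => z.1 i * z.2) (𝓝 1)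
      (𝓝 1) := by
    intro i
    have : Continuous (fun z : (Fin m → Endo n) × Endo n => z.1 i * z.2) := by fun_prop
    simpa using this.tendsto 1
  have hD : ContinuousAt D 1 := by
    rw [continuousAt_clm_apply]
    intro x
    rw [continuousAt_pi]
    intro i
    change ContinuousAt (fun z : (Fin m → Endo n) × Endo n =>
      fderiv ℂ (f i) (z.1 i * z.2) (z.1 i * (x * z.2))) 1
    refine ContinuousAt.clm_apply ?_ (by fun_prop)
    refine ContinuousAt.comp (f := fun z : (Fin m → Endo n) × Endo n => z.1 i * z.2)
      (g := fderiv ℂ (f i)) ?_ (by fun_prop)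
    simpa using (hf i).analyticAt.fderiv.continuousAt
  have hD1 : D 1 = jointDeriv f := by
    ext x i
    simp [D, M, jointDeriv]
  have ev1 : ∀ᶠ z in 𝓝 (1 : (Fin m → Endo n) × Endo n), Function.Surjective (D z) := by
    refine hD.eventually (isOpen_setOf_surjective_clm.mem_nhds ?_)
    rw [hD1]
    exact hsurj
  have ev2 : ∀ᶠ z in 𝓝 (1 : (Fin m → Endo n) × Endo n), ∀ i,
      AnalyticAt ℂ (f i) (z.1 i * z.2) ∧
      ∀ᶠ x in 𝓝 (z.1 i * z.2), translateFlag x E ∈ X i ↔ f i x = 0 := by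
    rw [Filter.eventually_all]
    exact fun i => (hmul i).eventually
      ((hf i).analyticAt.eventually_analyticAt.and (hf i).mem_iff.eventually_nhds)
  obtain ⟨S, hS, U, hU, hSU⟩ := mem_nhds_prod_iff.1 (Filter.inter_mem ev1 ev2)
  refine ⟨S, hS, U, hU, fun q hq h hh Y hY => ?_⟩
  obtain ⟨hDs, hz⟩ := hSU (Set.mk_mem_prod hq hh)
  change Function.Surjective (D (q, h)) at hDs
  have hDi : ∀ i, Function.Surjective ((fderiv ℂ (f i) (q i * h)).comp (M (q i) h)) :=
    fun i => (Function.surjective_eval i).comp hDs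
  have hM1 : ∀ i, M (q i) h 1 = q i * h := fun i => by simp [M]
  have hderiv : ∀ i, fderiv ℂ (f i ∘ M (q i) h) 1 =
      (fderiv ℂ (f i) (q i * h)).comp (M (q i) h) := by
    intro i
    refine HasFDerivAt.fderiv (HasFDerivAt.comp 1 ?_ (M (q i) h).hasFDerivAt)
    rw [hM1]
    exact (hz i).1.differentiableAt.hasFDerivAt
  refine ⟨fun i => LinearMap.ker ((fderiv ℂ (f i) (q i * h)).comp (M (q i) h)).toLinearMap,
    fun i => ⟨f i ∘ M (q i) h, ?_, ?_, ?_, ?_⟩, ?_⟩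
  · refine AnalyticAt.comp ?_ ((M (q i) h).analyticAt 1)
    rw [hM1]
    exact (hz i).1
  · have htend : Filter.Tendsto (M (q i) h) (𝓝 1) (𝓝 (q i * h)) := by
      rw [← hM1]
      exact (M (q i) h).continuous.tendsto 1
    filter_upwards [htend.eventually (hz i).2] with x hx
    rw [hY, ← translateFlag_mul, ← translateFlag_mul]
    change translateFlag (q i * (x * h)) E ∈ X i ↔ f i (q i * (x * h)) = 0 at hx
    rw [← mul_assoc] at hx
    rw [hx, mul_assoc]
    rfl
  · rw [hderiv]
    exact hDi i
  · rw [hderiv]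
  · have hinf : (⨅ i, LinearMap.ker
        ((fderiv ℂ (f i) (q i * h)).comp (M (q i) h)).toLinearMap) =
        LinearMap.ker (D (q, h)).toLinearMap := by
      ext x
      simp [D, funext_iff]
    rw [hinf, finrank_quotient_ker hDs, finrank_pi_fin]
    refine Finset.sum_congr rfl fun i _ => ?_
    rw [finrank_quotient_ker (hDi i)]
    simp

/-- Tangent spaces in general position are the same as a surjective joint differential of the
equations. -/
lemma jointDeriv_surjective {f : ∀ i, Endo n → Fin (c i) → ℂ}
    (hf : ∀ i, Function.Surjective (fderiv ℂ (f i) 1))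
    (hdim : Module.finrank ℂ (Endo n ⧸ (⨅ i, LinearMap.ker (fderiv ℂ (f i) 1).toLinearMap)) =
      ∑ i, Module.finrank ℂ (Endo n ⧸ LinearMap.ker (fderiv ℂ (f i) 1).toLinearMap)) :
    Function.Surjective (jointDeriv f) := by
  have hinf : (⨅ i, LinearMap.ker (fderiv ℂ (f i) 1).toLinearMap) =
      LinearMap.ker (jointDeriv f).toLinearMap := by
    ext x
    simp [jointDeriv, funext_iff]
  have hsum : ∑ i, Module.finrank ℂ (Endo n ⧸ LinearMap.ker (fderiv ℂ (f i) 1).toLinearMap) =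
      ∑ i, c i := Finset.sum_congr rfl fun i _ => by
    rw [finrank_quotient_ker (hf i)]
    simp
  rw [hinf, hsum, ← finrank_pi_fin, (jointDeriv f).toLinearMap.quotKerEquivRange.finrank_eq] at hdim
  exact LinearMap.range_eq_top.1 (Submodule.eq_top_of_finrank_eq hdim)

/-! ### Complex conjugation -/

/-- The complex conjugate of a subspace of `ℂⁿ`. -/
def conjSubmodule (A : Submodule ℂ (Fin n → ℂ)) : Submodule ℂ (Fin n → ℂ) where
  carrier := {v | star v ∈ A}
  add_mem' {_ _} hv hw := by
    rw [Set.mem_ofPred_eq, star_add]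
    exact A.add_mem hv hw
  zero_mem' := by
    change star 0 ∈ A
    rw [star_zero]
    exact A.zero_mem
  smul_mem' c _ hv := by
    rw [Set.mem_ofPred_eq, star_smul]
    exact A.smul_mem _ hv

lemma mem_conjSubmodule {A : Submodule ℂ (Fin n → ℂ)} {v : Fin n → ℂ} :
    v ∈ conjSubmodule A ↔ star v ∈ A := Iff.rfl

lemma conjSubmodule_eq_of_le {A : Submodule ℂ (Fin n → ℂ)} (h : A ≤ conjSubmodule A) :
    conjSubmodule A = A := by
  refine le_antisymm (fun v hv => ?_) h
  have := h hv
  rwa [mem_conjSubmodule, star_star] at this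

lemma finrank_conjSubmodule (A : Submodule ℂ (Fin n → ℂ)) :
    Module.finrank ℂ (conjSubmodule A) = Module.finrank ℂ A := by
  let e : conjSubmodule A ≃+ A :=
    { toFun := fun v => ⟨star (v : Fin n → ℂ), v.2⟩
      invFun := fun v => ⟨star (v : Fin n → ℂ), by rw [mem_conjSubmodule, star_star]; exact v.2⟩
      left_inv := fun v => Subtype.ext (star_star _)
      right_inv := fun v => Subtype.ext (star_star _)
      map_add' := fun v w => Subtype.ext (star_add _ _) }
  exact congrArg Cardinal.toNat (rank_eq_of_equiv_equiv (star : ℂ → ℂ) e star_involutive.bijective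
    fun r v => Subtype.ext (star_smul r (v : Fin n → ℂ)))

lemma conjSubmodule_mem_flagManifold {E : α → Submodule ℂ (Fin n → ℂ)}
    (hE : E ∈ flagManifold n α) : (fun a => conjSubmodule (E a)) ∈ flagManifold n α :=
  ⟨fun _ _ hab _ hv => hE.1 hab hv, fun a => (finrank_conjSubmodule _).trans (hE.2 a)⟩

/-- A Schubert variety defined by a real flag is stable under complex conjugation. -/
lemma conjSubmodule_mem_schubertVariety {σ : Equiv.Perm (Fin n)}
    {F : Fin (n + 1) → Submodule ℂ (Fin n → ℂ)} (hF : ∀ j, conjSubmodule (F j) = F j)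
    {E : α → Submodule ℂ (Fin n → ℂ)} (hE : E ∈ schubertVariety α σ F) :
    (fun a => conjSubmodule (E a)) ∈ schubertVariety α σ F := by
  refine ⟨conjSubmodule_mem_flagManifold hE.1, fun a j => ?_⟩
  have h : conjSubmodule (E a) ⊓ F j = conjSubmodule (E a ⊓ F j) := by
    nth_rewrite 1 [← hF j]
    rfl
  rw [h, finrank_conjSubmodule]
  exact hE.2 a j

lemma IsSecantAlong.conjSubmodule_eq {γ : ℝ → Fin n → ℝ} {I : Set ℝ}
    {F : Fin (n + 1) → Submodule ℂ (Fin n → ℂ)} (hF : IsSecantAlong γ I F) (j : Fin (n + 1)) :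
    conjSubmodule (F j) = F j := by
  refine conjSubmodule_eq_of_le ?_
  nth_rewrite 1 [← hF j]
  rw [Submodule.span_le]
  rintro _ ⟨hv, s, -, rfl⟩
  have hstar : star (complexify (γ s)) = complexify (γ s) :=
    funext fun i => Complex.conj_ofReal _
  change star (complexify (γ s)) ∈ F j
  rw [hstar]
  exact hv

lemma isRealFlag_iff {E : α → Submodule ℂ (Fin n → ℂ)} :
    IsRealFlag E ↔ (fun a => conjSubmodule (E a)) = E :=
  ⟨fun h => funext fun a => conjSubmodule_eq_of_le (h a),
    fun h a _ hv => (congrFun h a).ge hv⟩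

/-- The complex conjugate of an endomorphism of `ℂⁿ`. -/
noncomputable def conjEndo (h : Endo n) : Endo n :=
  LinearMap.toContinuousLinearMap
    { toFun := fun v => star (h (star v))
      map_add' := fun _ _ => by simp
      map_smul' := fun _ _ => by simp }

lemma conjEndo_apply (h : Endo n) (v : Fin n → ℂ) : conjEndo h v = star (h (star v)) := rfl

/-- Conjugation of endomorphisms is continuous at `1`, since it does not increase distances
to `1`. -/
lemma tendsto_conjEndo : Filter.Tendsto (conjEndo (n := n)) (𝓝 1) (𝓝 1) := by
  rw [tendsto_iff_norm_sub_tendsto_zero]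
  refine squeeze_zero (fun _ => norm_nonneg _) (fun h => ?_)
    (tendsto_iff_norm_sub_tendsto_zero.1 (Filter.tendsto_id (x := 𝓝 (1 : Endo n))))
  refine ContinuousLinearMap.opNorm_le_bound _ (norm_nonneg _) fun v => ?_
  have h1 : (conjEndo h - 1) v = star ((h - 1) (star v)) := by
    simp [conjEndo_apply]
  rw [h1, norm_star]
  exact ((h - 1).le_opNorm _).trans_eq (by rw [norm_star]; rfl)

lemma conjSubmodule_translateFlag (h : Endo n) {E : α → Submodule ℂ (Fin n → ℂ)}
    (hE : IsRealFlag E) :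
    (fun a => conjSubmodule (translateFlag h E a)) = translateFlag (conjEndo h) E := by
  funext a
  ext v
  constructor
  · rintro ⟨w, hw, hwv⟩
    refine ⟨star w, hE a w hw, ?_⟩
    change star (h (star (star w))) = v
    rw [star_star, ← star_star v]
    exact congrArg star hwv
  · rintro ⟨w, hw, rfl⟩
    refine ⟨star w, hE a w hw, ?_⟩
    change h (star w) = star (star (h (star w)))
    rw [star_star]

end SchubertCalculus

open SchubertCalculus Filter in
theorem mainTheorem1 (n m : ℕ) (α : Finset ℕ) (hα : ∀ a ∈ α, 0 < a ∧ a < n)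
    (γ : ℝ → Fin n → ℝ) (hγ : IsRationalNormalCurve γ)
    (σ : Fin m → Equiv.Perm (Fin n)) (δ : Fin m → ℕ)
    (hσ : IsGrassmannianSchubertProblem α σ δ)
    (hMC : MonotoneConjectureHolds γ α σ δ)
    (t : Fin m → ℝ) (ht : Function.Injective t) (hmono : IsMonotonePoints δ t) :
    ∃ ε : ℝ, 0 < ε ∧
      ∀ F : Fin m → Fin (n + 1) → Submodule ℂ (Fin n → ℂ),
        (∀ i, IsCompleteFlag (F i)) →
        (∀ i, ∃ u : ℝ, t i ∈ Set.Icc u (u + ε) ∧ IsSecantAlong γ (Set.Icc u (u + ε)) (F i)) →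
        IsTransverseWithAllPointsReal α σ F := by
  by_contra! hcon
  choose F hF hsec hbad using fun k : ℕ => hcon (1 / (k + 1)) Nat.one_div_pos_of_nat
  -- `E' k` is a point at which the intersection for the flags `F k` is not transverse or not real.
  have hpt : ∀ k, ∃ E' ∈ schubertIntersection α σ (F k),
      ¬ ((∃ T : Fin m → Submodule ℂ (Endo n),
        (∀ i, IsSmoothAt (schubertVariety α (σ i) (F k i)) E' (permLength (σ i)) (T i)) ∧
        Module.finrank ℂ (Endo n ⧸ (⨅ i, T i)) = ∑ i, Module.finrank ℂ (Endo n ⧸ T i)) ∧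
        IsRealFlag E') := by
    intro k
    by_contra! h
    exact hbad k ⟨fun E' hE' => (h E' hE').1, fun E' hE' => (h E' hE').2⟩
  choose E' hE' hE'bad using hpt
  obtain ⟨φ, hφ, E, hE, h, hh, hhE⟩ := exists_subseq_tendsto_flag (fun k => (hE' k).1)
  choose q hq hqu hqF using fun i => exists_endo_of_isSecantAlong hγ (t i) (fun k => hF k i)
    tendsto_one_div_add_atTop_nhds_zero_nat (fun k => hsec k i)
  have hmem : ∀ k i (E'' : α → Submodule ℂ (Fin n → ℂ)),
      E'' ∈ schubertVariety α (σ i) (F k i) ↔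
        translateFlag (q i k) E'' ∈ schubertVariety α (σ i) (osculatingFlag γ (t i)) :=
    fun k i E'' => (translateFlag_mem_schubertVariety_iff (hqu i k) (σ i) (hqF i k)).symm
  have hqφ : Tendsto (fun k i => q i (φ k)) atTop (𝓝 (1 : Fin m → Endo n)) :=
    tendsto_pi_nhds.2 fun i => (hq i).comp hφ.tendsto_atTop
  have hEX : ∀ i, E ∈ schubertVariety α (σ i) (osculatingFlag γ (t i)) := by
    intro i
    have hx := (tendsto_pi_nhds.1 hqφ i).mul hh
    rw [Pi.one_apply, one_mul] at hx
    refine mem_schubertVariety_of_tendsto hx ?_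
    filter_upwards [hhE] with k hk
    rw [translateFlag_mul, ← hk]
    exact (hmem _ i _).1 ((hE' (φ k)).2 i)
  obtain ⟨htrans, hreal⟩ := hMC t ht hmono
  have hEI : E ∈ schubertIntersection α σ fun i => osculatingFlag γ (t i) := ⟨hE, hEX⟩
  have hEreal := hreal E hEI
  obtain ⟨T, hT, hTdim⟩ := htrans E hEI
  choose f hfa hfm hfs hfT using hT
  obtain rfl : T = fun i => LinearMap.ker (fderiv ℂ (f i) 1).toLinearMap := funext hfT
  have hf : ∀ i, IsLocalEquation (schubertVariety α (σ i) (osculatingFlag γ (t i))) E (f i) :=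
    fun i => ⟨hfa i, hfm i⟩
  have hsurj := jointDeriv_surjective hfs hTdim
  have hker := ker_jointDeriv_eq hf hEX hE hsurj hσ.sum_permLength
  obtain ⟨S, hS, U, hU, huniq⟩ := exists_nhds_unique hf hker
  obtain ⟨S', hS', U', hU', htr⟩ := exists_nhds_transverse hf hsurj
  obtain ⟨k, hk, hkS, hkS', hkU, hkU', hkc⟩ :=
    (hhE.and ((hqφ.eventually_mem hS).and ((hqφ.eventually_mem hS').and
      ((hh.eventually_mem hU).and ((hh.eventually_mem hU').and
        ((tendsto_conjEndo.comp hh).eventually_mem hU)))))).exists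
  refine hE'bad (φ k) ⟨?_, ?_⟩
  · rw [hk]
    exact htr _ hkS' _ hkU' _ fun i E'' => hmem (φ k) i E''
  · -- The conjugate of `E' (φ k)` also lies in the intersection and is close to `E`, which is real.
    have hconj := conjSubmodule_translateFlag (h k) hEreal
    rw [isRealFlag_iff, hk, hconj]
    refine huniq _ hkS _ hkc _ hkU (fun i => ?_) (fun i => ?_)
    · rw [← hmem, Function.comp_apply, ← hconj, ← hk]
      obtain ⟨u, -, hu⟩ := hsec (φ k) i
      exact conjSubmodule_mem_schubertVariety hu.conjSubmodule_eq ((hE' (φ k)).2 i)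
    · rw [← hmem, ← hk]
      exact (hE' (φ k)).2 i
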